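/- Let $Q\colon \mathbb{C}[x]\to\mathbb{C}[x]$ be a delta operator, i.e. a linear operator that lowers the degree of polynomials by one (and kills constants) and commutes with all shifts $f(x)\mapsto f(x+a)$, $a\in\mathbb{C}$. Then $Q=a_1D+a_2D^2+a_3D^3+\cdots$ with $D=\frac{d}{dx}$ and $a_k=\frac{1}{k!}(Qx^k)(0)$, and by this formula $Q$ also acts on the field $\mathbb{C}((x^{-1}))$ of formal series $\sum_{k\le n}c_kx^k$. Assume that $Q$ is normalized: $a_1=1$. Let $\{p_n(x)\}_{n\ge 0}$ be the basic polynomials of $Q$, determined by $Qp_n=np_{n-1}$ and $p_n(0)=\delta_{n,0}$, and put $p^*_n(x)=x^{-1}p_{n+1}(x)$ for $n\ge 0$. Extend both families to all $n\in\mathbb{Z}$, as elements of $\mathbb{C}((x^{-1}))$, by $p^*_{-1}(x)=x^{-1}$, $Qp^*_n=np^*_{n-1}$ for $n\le -1$, and $p_{n+1}(x)=x\,p^*_n(x)$ for all $n$. Let $N\ge 1$. For integers $l\ge 0$ define elements of $\mathbb{C}(x_1,\ldots,x_N)$ by $$h_l(x_1,\ldots,x_N)=\frac{\det\bigl(p_{\lambda_i+N-i}(x_j)\bigr)_{1\le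 i,j\le N}}{\det\bigl(p_{N-i}(x_j)\bigr)_{1\le i,j\le N}},\qquad h^*_l(x_1,\ldots,x_N)=\frac{\det\bigl(p^*_{\lambda_i+N-i}(x_j)\bigr)_{1\le i,j\le N}}{\det\bigl(p^*_{N-i}(x_j)\bigr)_{1\le i,j\le N}},$$ where $\lambda=(\lambda_1,\ldots,\lambda_N)=(l,0,\ldots,0)$. Then, as equalities of formal series in $u^{-1}$ with coefficients in $\mathbb{C}(x_1,\ldots,x_N)$, $$\frac{1}{(u+x_1)\cdots(u+x_N)}=\sum_{l\ge 0}(-1)^l\,h_l(x_1,\ldots,x_N)\,p^*_{-N-l}(u)=\sum_{l\ge 0}(-1)^l\,h^*_l(x_1,\ldots,x_N)\,p_{-N-l}(u),$$ where both sums are formally summable: the powers of $u$ that occur are bounded above, and each power of $u$ occurs in only finitely many terms. -/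

import Mathlib

open Polynomial

noncomputable section

namespace BinomialSchur

/-! ### Delta operators and their basic polynomials -/

/-- A delta operator on `ℂ[x]`: a linear operator that lowers the degree of polynomials by one
(killing the constants) and commutes with all shifts `f(x) ↦ f(x + a)`. -/
structure DeltaOperator where
  toLin : ℂ[X] →ₗ[ℂ] ℂ[X]
  map_const : ∀ c : ℂ, toLin (C c) = 0
  degree_map : ∀ f : ℂ[X], 0 < f.degree → (toLin f).degree + 1 = f.degree
  shift_comm : ∀ (a : ℂ) (f : ℂ[X]), toLin (f.comp (X + C a)) = (toLin f).comp (X + C a)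

/-- The coefficient `a_k` in the expansion `Q = a_1 D + a_2 D² + ⋯` with `D = d/dx`:
it is `(Q x^k)(0) / k!`. -/
def DeltaOperator.symbolCoeff (Q : DeltaOperator) (k : ℕ) : ℂ :=
  (Q.toLin (X ^ k)).eval 0 / (k.factorial : ℂ)

/-- The numbers `a_k` are indeed the coefficients of `Q` as a power series in `D`. -/
theorem DeltaOperator.toLin_eq_sum (Q : DeltaOperator) (f : ℂ[X]) :
    Q.toLin f = ∑ k ∈ Finset.range (f.natDegree + 1), Q.symbolCoeff k • (derivative^[k] f) := by
  refine Polynomial.funext fun a => ?_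
  have h1 : (Q.toLin f).eval a = (Q.toLin (taylor a f)).eval 0 := by
    rw [taylor_apply, Q.shift_comm]
    simp
  rw [h1]
  conv_lhs => rw [(taylor a f).as_sum_range' (f.natDegree + 1) (by simp)]
  simp only [map_sum, eval_finsetSum, eval_smul, smul_eq_mul]
  refine Finset.sum_congr rfl fun k _ => ?_
  have hk : (k.factorial : ℂ) ≠ 0 := by exact_mod_cast k.factorial_ne_zero
  rw [← C_mul_X_pow_eq_monomial, ← smul_eq_C_mul, map_smul, eval_smul, taylor_coeff,
    smul_eq_mul, DeltaOperator.symbolCoeff]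
  have h2 : (k.factorial : ℂ) * (hasseDeriv k f).eval a = (derivative^[k] f).eval a := by
    rw [← factorial_smul_hasseDeriv (R := ℂ) k]
    simp
  rw [← h2]
  field_simp

/-- `Q` is normalized: the coefficient of `D` in `Q` is equal to `1`. -/
def DeltaOperator.IsNormalized (Q : DeltaOperator) : Prop := Q.symbolCoeff 1 = 1

/-- Existence and uniqueness behind the recursive definition of the basic polynomials. -/
theorem DeltaOperator.existsUnique_preimage (Q : DeltaOperator) (g : ℂ[X]) :
    ∃! q : ℂ[X], Q.toLin q = g ∧ q.eval 0 = 0 := by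
  have hker : ∀ q : ℂ[X], Q.toLin q = 0 → q.eval 0 = 0 → q = 0 := by
    intro q h0 h1
    by_cases hd : 0 < q.degree
    · have := Q.degree_map q hd
      rw [h0, degree_zero, WithBot.bot_add] at this
      rw [← this] at hd
      exact absurd hd (by simp)
    · have h2 := eq_C_of_degree_le_zero (not_lt.1 hd)
      rw [h2, eval_C] at h1
      rw [h2, h1, C_0]
  have hex : ∀ (n : ℕ) (g : ℂ[X]), g.degree < n → ∃ q : ℂ[X], Q.toLin q = g := by
    intro n
    induction n with
    | zero =>
      intro g hg
      refine ⟨0, ?_⟩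
      have : g = 0 := by
        by_contra hne
        exact absurd hg (not_lt.2 (by exact_mod_cast zero_le_degree_iff.2 hne))
      rw [this, map_zero]
    | succ n ih =>
      intro g hg
      have hX : (X ^ (n + 1) : ℂ[X]).degree = ((n + 1 : ℕ) : WithBot ℕ) := degree_X_pow _
      have h1 := Q.degree_map (X ^ (n + 1)) (by rw [hX]; exact_mod_cast Nat.succ_pos n)
      set r := Q.toLin (X ^ (n + 1)) with hr
      have hrd : r.degree = (n : WithBot ℕ) := by
        rw [hX] at h1
        have hr0 : r ≠ 0 := by
          intro h
          rw [h, degree_zero, WithBot.bot_add] at h1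
          exact absurd h1 (WithBot.bot_ne_coe)
        rw [degree_eq_natDegree hr0] at h1 ⊢
        have h2 : r.natDegree + 1 = n + 1 := by exact_mod_cast h1
        have h3 : r.natDegree = n := by omega
        rw [h3]
      have hrn : r.natDegree = n := natDegree_eq_of_degree_eq_some hrd
      have hlead : r.coeff n ≠ 0 := by
        have : r.leadingCoeff ≠ 0 := by
          rw [Ne, leadingCoeff_eq_zero]
          rintro h
          rw [h, degree_zero] at hrd
          exact absurd hrd (WithBot.bot_ne_coe)
        rwa [leadingCoeff, hrn] at this
      obtain ⟨q, hq⟩ := ih (g - (g.coeff n / r.coeff n) • r) (by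
        rw [degree_lt_iff_coeff_zero]
        intro m hm
        rcases Nat.eq_or_lt_of_le hm with h | h
        · subst h
          simp [div_mul_cancel₀ _ hlead]
        · have h3 : g.coeff m = 0 := (degree_lt_iff_coeff_zero g (n + 1)).1 hg m h
          have h4 : r.coeff m = 0 := coeff_eq_zero_of_natDegree_lt (by omega)
          simp [h3, h4])
      refine ⟨q + (g.coeff n / r.coeff n) • X ^ (n + 1), ?_⟩
      rw [map_add, map_smul, hq, ← hr]
      abel
  obtain ⟨q, hq⟩ := hex (g.natDegree + 1) g
    (lt_of_le_of_lt degree_le_natDegree (by exact_mod_cast Nat.lt_succ_self _))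
  refine ⟨q - C (q.eval 0), ⟨by rw [map_sub, hq, Q.map_const, sub_zero], by simp⟩, ?_⟩
  rintro q' ⟨h1, h2⟩
  refine sub_eq_zero.1 (hker _ ?_ ?_)
  · rw [map_sub, map_sub, h1, hq, Q.map_const, sub_zero, sub_self]
  · simp [h2]

/-- The basic polynomials `p_n`, `n ≥ 0`, of `Q`: the polynomials determined by `p_0 = 1`,
`Q p_{n+1} = (n+1) p_n` and `p_{n+1}(0) = 0`. -/
def basic (Q : DeltaOperator) : ℕ → ℂ[X]
  | 0 => 1
  | n + 1 => (Q.existsUnique_preimage (((n : ℂ) + 1) • basic Q n)).choose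

theorem toLin_basic_succ (Q : DeltaOperator) (n : ℕ) :
    Q.toLin (basic Q (n + 1)) = ((n : ℂ) + 1) • basic Q n :=
  (Q.existsUnique_preimage (((n : ℂ) + 1) • basic Q n)).choose_spec.1.1

theorem eval_basic_succ (Q : DeltaOperator) (n : ℕ) : (basic Q (n + 1)).eval 0 = 0 :=
  (Q.existsUnique_preimage (((n : ℂ) + 1) • basic Q n)).choose_spec.1.2

/-- The polynomials `p*_n(x) = x⁻¹ p_{n+1}(x)`, `n ≥ 0`. -/
def basicStar (Q : DeltaOperator) (n : ℕ) : ℂ[X] := (basic Q (n + 1)).divX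

theorem X_mul_basicStar (Q : DeltaOperator) (n : ℕ) : X * basicStar Q n = basic Q (n + 1) := by
  have h := divX_mul_X_add (basic Q (n + 1))
  rw [coeff_zero_eq_eval_zero, eval_basic_succ, C_0, add_zero] at h
  rw [basicStar, mul_comm, h]

/-! ### Series in descending powers

For a ring `R`, the ring `R((x⁻¹))` of formal series `∑_{k ≤ n} a_k x^k` is `LaurentSeries R` with
`x⁻¹` as the uniformizer: the coefficient of `x^k` is `f.coeff (-k)`. -/

/-- The variable `x` of `R((x⁻¹))`. -/
def invX (R : Type*) [CommRing R] : LaurentSeries R := HahnSeries.single (-1) 1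

/-- A polynomial in `x`, as an element of `ℂ((x⁻¹))`. -/
def ofPoly (f : ℂ[X]) : LaurentSeries ℂ := aeval (invX ℂ) f

/-- The derivation `D = d/dx` of `ℂ((x⁻¹))`. With `t = x⁻¹` it is `-t² d/dt`. -/
def xDeriv (f : LaurentSeries ℂ) : LaurentSeries ℂ :=
  -(HahnSeries.single 2 1 * LaurentSeries.derivative ℂ f)

theorem coeff_xDeriv (f : LaurentSeries ℂ) (m : ℤ) :
    (xDeriv f).coeff (m + 1) = -((m : ℂ) * f.coeff m) := by
  have h : m + 1 = (m - 1) + 2 := by ring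
  rw [xDeriv, HahnSeries.coeff_neg, h, HahnSeries.coeff_single_mul_add,
    LaurentSeries.derivative_apply, LaurentSeries.hasseDeriv_coeff]
  simp

/-- `D x^k = k x^{k-1}` for every integer `k`. -/
theorem xDeriv_single (k : ℤ) :
    xDeriv (HahnSeries.single (-k) 1) = HahnSeries.single (-(k - 1)) (k : ℂ) := by
  ext m
  obtain ⟨m, rfl⟩ : ∃ m', m = m' + 1 := ⟨m - 1, by ring⟩
  rw [coeff_xDeriv]
  by_cases h : m = -k
  · subst h
    rw [HahnSeries.coeff_single_same, show -k + 1 = -(k - 1) by ring,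
      HahnSeries.coeff_single_same]
    simp
  · rw [HahnSeries.coeff_single_of_ne h, HahnSeries.coeff_single_of_ne (by omega)]
    simp

theorem coeff_xDeriv_iterate_eq_zero (f : LaurentSeries ℂ) (k : ℕ) (m : ℤ)
    (hm : m < f.order + k) : (xDeriv^[k] f).coeff m = 0 := by
  induction k generalizing m with
  | zero => exact HahnSeries.coeff_eq_zero_of_lt_order (by simpa using hm)
  | succ k ih =>
    obtain ⟨m, rfl⟩ : ∃ m', m = m' + 1 := ⟨m - 1, by ring⟩
    rw [Function.iterate_succ_apply', coeff_xDeriv, ih m (by push_cast at hm; omega)]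
    simp

/-- The summable family `a_k D^k f`, `k ≥ 0`, in `ℂ((x⁻¹))`. -/
def deltaFamily (Q : DeltaOperator) (f : LaurentSeries ℂ) :
    HahnSeries.SummableFamily ℤ ℂ ℕ where
  toFun k := Q.symbolCoeff k • (xDeriv^[k] f)
  isPWO_iUnion_support' := by
    refine (BddBelow.isWF (s := ⋃ k : ℕ, (Q.symbolCoeff k • (xDeriv^[k] f)).support)
      ⟨f.order, ?_⟩).isPWO
    intro m hm
    obtain ⟨k, hk⟩ := Set.mem_iUnion.1 hm
    by_contra hlt
    refine hk ?_
    rw [HahnSeries.coeff_smul, coeff_xDeriv_iterate_eq_zero f k m (by omega), smul_zero]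
  finite_co_support' m := by
    refine (Set.finite_le_nat (m - f.order).toNat).subset ?_
    intro k hk
    by_contra hlt
    refine hk ?_
    rw [HahnSeries.coeff_smul, coeff_xDeriv_iterate_eq_zero f k m
      (by simp only [Set.mem_ofPred_eq] at hlt; omega), smul_zero]

/-- The action `∑_k a_k D^k` of the delta operator `Q` on `ℂ((x⁻¹))`. -/
def deltaSeries (Q : DeltaOperator) (f : LaurentSeries ℂ) : LaurentSeries ℂ :=
  (deltaFamily Q f).hsum

/-- `p*_{-1-m}` for `m ≥ 0`, determined by `p*_{-1} = x⁻¹` and `Q p*_n = n p*_{n-1}`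
for `n = -1, -2, …`. -/
def basicStarNeg (Q : DeltaOperator) : ℕ → LaurentSeries ℂ
  | 0 => HahnSeries.single 1 1
  | m + 1 => (-((m : ℂ) + 1))⁻¹ • deltaSeries Q (basicStarNeg Q m)

/-- The family `p*_n`, `n ∈ ℤ`, in `ℂ((x⁻¹))`. -/
def basicStarZ (Q : DeltaOperator) : ℤ → LaurentSeries ℂ
  | Int.ofNat n => ofPoly (basicStar Q n)
  | Int.negSucc m => basicStarNeg Q m

/-- The family `p_n = x p*_{n-1}`, `n ∈ ℤ`, in `ℂ((x⁻¹))`. -/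
def basicZ (Q : DeltaOperator) (n : ℤ) : LaurentSeries ℂ := invX ℂ * basicStarZ Q (n - 1)

/-- For `n ≥ 0` the family `basicZ` consists of the basic polynomials. -/
theorem basicZ_natCast (Q : DeltaOperator) (n : ℕ) : basicZ Q n = ofPoly (basic Q n) := by
  cases n with
  | zero =>
    change HahnSeries.single (-1) 1 * HahnSeries.single 1 1 = aeval (invX ℂ) (1 : ℂ[X])
    simp
  | succ n =>
    have h : ((n + 1 : ℕ) : ℤ) - 1 = Int.ofNat n := by simp
    rw [basicZ, h, ← X_mul_basicStar]
    simp [basicStarZ, ofPoly]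

/-! ### Schur type functions -/

/-- The field `ℂ(x_1, …, x_N)`. -/
def RatField (N : ℕ) : Type := FractionRing (MvPolynomial (Fin N) ℂ)

instance (N : ℕ) : Field (RatField N) :=
  inferInstanceAs (Field (FractionRing (MvPolynomial (Fin N) ℂ)))

instance (N : ℕ) : Algebra (MvPolynomial (Fin N) ℂ) (RatField N) :=
  inferInstanceAs (Algebra (MvPolynomial (Fin N) ℂ) (FractionRing (MvPolynomial (Fin N) ℂ)))

instance (N : ℕ) : IsFractionRing (MvPolynomial (Fin N) ℂ) (RatField N) :=
  inferInstanceAs (IsFractionRing (MvPolynomial (Fin N) ℂ)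
    (FractionRing (MvPolynomial (Fin N) ℂ)))

instance (N : ℕ) : Algebra ℂ (RatField N) :=
  inferInstanceAs (Algebra ℂ (FractionRing (MvPolynomial (Fin N) ℂ)))

instance (N : ℕ) : IsScalarTower ℂ (MvPolynomial (Fin N) ℂ) (RatField N) :=
  inferInstanceAs (IsScalarTower ℂ (MvPolynomial (Fin N) ℂ)
    (FractionRing (MvPolynomial (Fin N) ℂ)))

/-- The variable `x_j` in `ℂ(x_1, …, x_N)`. -/
def var (N : ℕ) (j : Fin N) : RatField N :=
  algebraMap (MvPolynomial (Fin N) ℂ) (RatField N) (MvPolynomial.X j)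

/-- `det (q_{λ_i + N - i}(x_j))`; the rows and columns are numbered from `0` here. -/
def schurNum {N : ℕ} (q : ℕ → ℂ[X]) (l : Fin N → ℕ) : RatField N :=
  Matrix.det (Matrix.of fun i j : Fin N => aeval (var N j) (q (l i + (N - 1 - (i : ℕ)))))

/-- The Schur type function `det (q_{λ_i + N - i}(x_j)) / det (q_{N - i}(x_j))`. -/
def schur {N : ℕ} (q : ℕ → ℂ[X]) (l : Fin N → ℕ) : RatField N :=
  schurNum q l / schurNum q 0

/-- The sequence `(k) = (k, 0, …, 0)` of length `N`. -/
def oneRow (N k : ℕ) : Fin N → ℕ := fun i => if (i : ℕ) = 0 then k else 0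

/-- `h_k(x_1, …, x_N) = s_{(k)}(x_1, …, x_N)`, `k ≥ 0`. -/
def hSchur (Q : DeltaOperator) (N k : ℕ) : RatField N := schur (basic Q) (oneRow N k)

/-- `h*_k(x_1, …, x_N) = s*_{(k)}(x_1, …, x_N)`, `k ≥ 0`. -/
def hStarSchur (Q : DeltaOperator) (N k : ℕ) : RatField N := schur (basicStar Q) (oneRow N k)

/-! ### Formal sums -/

/-- `a` is the formal sum of the series `f 0, f 1, …` in `R((u⁻¹))`: the powers of `u` occurring in
them are bounded above, every power occurs in finitely many of them, and `a` is obtained by adding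
the coefficients of each power. -/
def HasFormalSum {R : Type*} [CommRing R] (f : ℕ → LaurentSeries R) (a : LaurentSeries R) : Prop :=
  ∃ s : HahnSeries.SummableFamily ℤ R ℕ, (∀ l, s l = f l) ∧ s.hsum = a

/-- An element of `ℂ((u⁻¹))`, as an element of `ℂ(x_1, …, x_N)((u⁻¹))`. -/
def baseChange (N : ℕ) (f : LaurentSeries ℂ) : LaurentSeries (RatField N) :=
  f.map (algebraMap ℂ (RatField N))

end BinomialSchur

end

/-! The case $N=1$ is a pair of expansions of the kernel $(u+x)^{-1}$. Pair $\mathbb{C}[x]$ with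
$\mathbb{C}((u^{-1}))$ so that $x^k$ is dual to $(-1)^ku^{-1-k}$. Then $D$, and hence $Q$, on series
is adjoint to $D$, $Q$ on polynomials (`dualPairing_deltaSeries`). As $u^{-1}$ represents evaluation
at $0$, $p^*_{-1-n}$ represents $f\mapsto(-1)^n(Q^nf)(0)/n!$, which up to sign is the coefficient of
$p_n$ in $f$ (`eq_sum_basic`). Taking $f=x^k$ for all $k$ gives
$(u+x)^{-1}=\sum(-1)^np_n(x)p^*_{-1-n}(u)$ (`hasFormalSum_basic`); removing the term $n=0$ and
multiplying by $-u/x$ gives the companion with $p^*_n(x)p_{-1-n}(u)$ (`hasFormalSum_basicStar`).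

For $N=M+1$ variables, let $q$ be either family and replace the first row of $(q_{M-i}(x_j))$ by
$((u+x_j)^{-1})$. Expanding this row by the kernel formula, the terms $n<M$ have two equal rows, and
$n=M+l$ gives the numerator of the one-row function. On the other hand, multiplying the determinant
by $\prod(u+x_j)$ leaves monic polynomials of degrees $0,M,\ldots,1$ in the rows, so the product is
$(-1)^M$ times the original determinant (`prod_mul_det_updateRow_inv`). Comparison proves both
identities (`hasFormalSum_prod_inv`). -/

open Polynomial

noncomputable section

namespace BinomialSchur

/-! ### Formal sums -/

namespace HasFormalSum

variable {R : Type*} [CommRing R] {f g : ℕ → LaurentSeries R} {a b : LaurentSeries R}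

theorem mul_left (h : HasFormalSum f a) (c : LaurentSeries R) :
    HasFormalSum (fun n => c * f n) (c * a) := by
  obtain ⟨s, hs, rfl⟩ := h
  exact ⟨c • s, fun l => by
    rw [HahnSeries.SummableFamily.smul_apply, HahnSeries.of_symm_smul_of_eq_mul, hs], by rw [HahnSeries.SummableFamily.hsum_smul]⟩

theorem sub (hf : HasFormalSum f a) (hg : HasFormalSum g b) :
    HasFormalSum (fun n => f n - g n) (a - b) := by
  obtain ⟨s, hs, rfl⟩ := hf
  obtain ⟨t, ht, rfl⟩ := hg
  exact ⟨s - t, fun l => by simp [hs, ht], by rw [HahnSeries.SummableFamily.hsum_sub]⟩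

theorem sum {ι : Type*} (I : Finset ι) {F : ι → ℕ → LaurentSeries R} {A : ι → LaurentSeries R}
    (h : ∀ i, HasFormalSum (F i) (A i)) :
    HasFormalSum (fun n => ∑ i ∈ I, F i n) (∑ i ∈ I, A i) := by
  choose s hs hA using h
  refine ⟨∑ i ∈ I, s i, fun l => ?_, ?_⟩
  · classical
    induction I using Finset.induction_on with
    | empty => simp
    | insert i I hi ih => simpa [Finset.sum_insert hi, hs] using ih
  · exact (map_sum HahnSeries.SummableFamily.lsum s I).trans
      (Finset.sum_congr rfl fun i _ => hA i)

theorem single (x : LaurentSeries R) : HasFormalSum (Pi.single 0 x) x :=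
  ⟨HahnSeries.SummableFamily.single 0 x, fun _ => rfl, HahnSeries.SummableFamily.hsum_single 0 x⟩

/-- Vanishing initial terms may be dropped. -/
theorem drop (h : HasFormalSum f a) (M : ℕ) (h0 : ∀ n < M, f n = 0) :
    HasFormalSum (fun l => f (M + l)) a := by
  obtain ⟨s, hs, rfl⟩ := h
  let t : HahnSeries.SummableFamily ℤ R ℕ :=
    { toFun := fun l => s (M + l)
      isPWO_iUnion_support' := s.isPWO_iUnion_support.mono
        (Set.iUnion_subset fun l => Set.subset_iUnion (fun n => (s n).support) (M + l))
      finite_co_support' := fun m =>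
        (s.finite_co_support m).preimage (addLeftEmbedding M).injective.injOn }
  -- Extending the tail by zero along $l\mapsto M+l$ recovers the whole family, and this does not
  -- change the sum.
  have ht : t.embDomain (addLeftEmbedding M) = s := by
    refine HahnSeries.SummableFamily.ext fun n => ?_
    by_cases hn : n < M
    · rw [HahnSeries.SummableFamily.embDomain_of_notMem_range, hs, h0 n hn]
      rintro ⟨l, rfl⟩
      simp at hn
    · obtain ⟨l, rfl⟩ := Nat.exists_eq_add_of_le (not_lt.1 hn)
      exact HahnSeries.SummableFamily.embDomain_image t (addLeftEmbedding M)
  refine ⟨t, fun l => hs (M + l), ?_⟩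
  rw [← ht, HahnSeries.SummableFamily.hsum_embDomain]

/-- The series `f 0, f 1, …` of increasing order of vanishing can be summed coefficientwise. -/
theorem of_coeff (h0 : ∀ (n : ℕ) (m : ℤ), m ≤ n → (f n).coeff m = 0)
    (ha : ∀ m : ℤ, ∑ n ∈ Finset.range m.toNat, (f n).coeff m = a.coeff m) :
    HasFormalSum f a := by
  let s : HahnSeries.SummableFamily ℤ R ℕ :=
    { toFun := f
      isPWO_iUnion_support' := by
        refine (BddBelow.isWF (s := ⋃ n : ℕ, (f n).support) ⟨0, fun m hm => ?_⟩).isPWO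
        obtain ⟨n, hn⟩ := Set.mem_iUnion.1 hm
        by_contra hlt
        exact hn (h0 n m (by omega))
      finite_co_support' := fun m => by
        refine (Set.finite_lt_nat m.toNat).subset fun n hn => ?_
        by_contra hlt
        exact hn (h0 n m (by simp only [Set.mem_ofPred_eq] at hlt; omega)) }
  refine ⟨s, fun _ => rfl, ?_⟩
  ext m
  rw [← ha m]
  refine HahnSeries.SummableFamily.coeff_hsum_eq_sum_of_subset fun n hn => ?_
  by_contra hlt
  rw [Finset.coe_range, Set.mem_Iio] at hlt
  exact hn (h0 n m (by omega))

end HasFormalSum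

/-! ### The geometric series for $(u+x)^{-1}$. -/

theorem inv_invX_add_C {K : Type*} [Field K] (x : K) :
    (invX K + HahnSeries.C x)⁻¹ =
      HahnSeries.single 1 1 * HahnSeries.ofPowerSeries ℤ K (PowerSeries.mk fun k => (-x) ^ k) := by
  have hP : (1 + PowerSeries.C x * PowerSeries.X) * (PowerSeries.mk fun k => (-x) ^ k) = 1 := by
    ext k
    cases k with
    | zero => simp [add_mul, mul_assoc]
    | succ k =>
      rw [add_mul, mul_assoc, one_mul, map_add, PowerSeries.coeff_C_mul,
        PowerSeries.coeff_succ_X_mul]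
      simp [pow_succ, PowerSeries.coeff_one]
      ring
  have hu : (invX K + HahnSeries.C x) * HahnSeries.single 1 1 =
      HahnSeries.ofPowerSeries ℤ K (1 + PowerSeries.C x * PowerSeries.X) := by
    simp [invX, add_mul]
  refine inv_eq_of_mul_eq_one_right ?_
  rw [← mul_assoc, hu, ← map_mul, hP, map_one]

/-- `(u + x)⁻¹ = ∑_k (-x)^k u^{-1-k}`. -/
theorem coeff_inv_invX_add_C {K : Type*} [Field K] (x : K) (k : ℕ) :
    ((invX K + HahnSeries.C x)⁻¹).coeff ((k : ℤ) + 1) = (-x) ^ k := by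
  rw [inv_invX_add_C, HahnSeries.coeff_single_mul_add, one_mul,
    HahnSeries.ofPowerSeries_apply_coeff, PowerSeries.coeff_mk]

theorem coeff_inv_invX_add_C_of_nonpos {K : Type*} [Field K] (x : K) {m : ℤ} (hm : m ≤ 0) :
    ((invX K + HahnSeries.C x)⁻¹).coeff m = 0 := by
  obtain ⟨m, rfl⟩ : ∃ m', m = m' + 1 := ⟨m - 1, by ring⟩
  rw [inv_invX_add_C, HahnSeries.coeff_single_mul_add, one_mul, HahnSeries.ofPowerSeries_apply]
  refine HahnSeries.embDomain_of_notMem_range ?_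
  rintro ⟨k, hk⟩
  have : (k : ℤ) = m := hk
  omega

/-! ### Basic polynomials -/

theorem DeltaOperator.symbolCoeff_zero (Q : DeltaOperator) : Q.symbolCoeff 0 = 0 := by
  have h := Q.map_const 1
  rw [C_1] at h
  simp [symbolCoeff, h]

theorem DeltaOperator.natDegree_toLin_le (Q : DeltaOperator) (f : ℂ[X]) :
    (Q.toLin f).natDegree ≤ f.natDegree - 1 := by
  by_cases hd : 0 < f.degree
  · have h := Q.degree_map f hd
    have hf : f ≠ 0 := by rintro rfl; simp at hd
    have h0 : Q.toLin f ≠ 0 := by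
      intro h0
      rw [h0, degree_zero, WithBot.bot_add] at h
      rw [← h] at hd
      simp at hd
    rw [degree_eq_natDegree hf, degree_eq_natDegree h0] at h
    have : (Q.toLin f).natDegree + 1 = f.natDegree := by exact_mod_cast h
    omega
  · rw [eq_C_of_degree_le_zero (not_lt.1 hd), Q.map_const]
    simp

/-- The coefficient of `x^n` in `Q f`, when `f` has degree at most `n + 1`. -/
theorem DeltaOperator.coeff_toLin (Q : DeltaOperator) (hQ : Q.IsNormalized) {f : ℂ[X]} {n : ℕ}
    (hf : f.natDegree ≤ n + 1) : (Q.toLin f).coeff n = (n + 1) * f.coeff (n + 1) := by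
  rw [Q.toLin_eq_sum, finsetSum_coeff]
  -- There is no $D^0$ term, and for $k\ge2$ the derivative $D^kf$ has no $x^n$ term, since $n+k$
  -- exceeds the degree of $f$.
  have h : ∀ k, k ≠ 1 → (Q.symbolCoeff k • derivative^[k] f).coeff n = 0 := by
    intro k hk
    rcases Nat.lt_or_gt_of_ne hk with h | h
    · obtain rfl : k = 0 := by omega
      simp [Q.symbolCoeff_zero]
    · rw [coeff_smul, coeff_iterate_derivative, coeff_eq_zero_of_natDegree_lt (by omega)]
      simp
  by_cases h1 : 1 ∈ Finset.range (f.natDegree + 1)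
  · rw [Finset.sum_eq_single_of_mem 1 h1 fun k _ hk => h k hk, hQ]
    simp [coeff_derivative, mul_comm]
  · have : f.natDegree = 0 := by simp at h1; omega
    rw [coeff_eq_zero_of_natDegree_lt (by omega), mul_zero]
    refine Finset.sum_eq_zero fun k hk => h k ?_
    rintro rfl
    exact h1 hk

theorem basic_zero (Q : DeltaOperator) : basic Q 0 = 1 := by rw [basic]

theorem natDegree_basic (Q : DeltaOperator) (n : ℕ) : (basic Q n).natDegree = n := by
  induction n with
  | zero => simp [basic_zero]
  | succ n ih =>
    have hn : ((n : ℂ) + 1) ≠ 0 := by exact_mod_cast n.succ_ne_zero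
    have h := toLin_basic_succ Q n
    have hne : basic Q n ≠ 0 := by
      intro h0
      cases n with
      | zero => simp [basic_zero] at h0
      | succ n => rw [h0] at ih; simp at ih
    have hd : 0 < (basic Q (n + 1)).degree := by
      by_contra hd
      rw [eq_C_of_degree_le_zero (not_lt.1 hd), Q.map_const] at h
      exact smul_ne_zero hn hne h.symm
    have h1 := Q.degree_map _ hd
    have h2 : basic Q (n + 1) ≠ 0 := by intro h0; simp [h0] at hd
    rw [h, smul_eq_C_mul, degree_C_mul hn, degree_eq_natDegree hne,
      degree_eq_natDegree h2, ih] at h1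
    exact_mod_cast h1.symm

/-- Normalization enters here: comparing leading coefficients in $Qp_{n+1}=(n+1)p_n$ cancels the
factor $n+1$. -/
theorem monic_basic (Q : DeltaOperator) (hQ : Q.IsNormalized) (n : ℕ) : (basic Q n).Monic := by
  induction n with
  | zero => simp [basic_zero]
  | succ n ih =>
    have hn : ((n : ℂ) + 1) ≠ 0 := by exact_mod_cast n.succ_ne_zero
    have h := Q.coeff_toLin hQ (natDegree_basic Q (n + 1)).le
    rw [toLin_basic_succ, coeff_smul, smul_eq_mul] at h
    have h1 : (basic Q n).coeff n = 1 := by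
      simpa [Monic, leadingCoeff, natDegree_basic] using ih
    rw [Monic, leadingCoeff, natDegree_basic, ← mul_left_cancel₀ hn h, h1]

theorem natDegree_basicStar (Q : DeltaOperator) (n : ℕ) : (basicStar Q n).natDegree = n := by
  rw [basicStar, natDegree_divX_eq_natDegree_tsub_one, natDegree_basic, Nat.add_sub_cancel]

theorem monic_basicStar (Q : DeltaOperator) (hQ : Q.IsNormalized) (n : ℕ) :
    (basicStar Q n).Monic := by
  have h := monic_basic Q hQ (n + 1)
  rw [← X_mul_basicStar] at h
  exact Monic.of_mul_monic_left monic_X h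

/-- Expansion of a polynomial in the basic polynomials. -/
theorem eq_sum_basic (Q : DeltaOperator) (d : ℕ) (f : ℂ[X]) (hf : f.natDegree ≤ d) :
    f = ∑ n ∈ Finset.range (d + 1),
      (((Q.toLin ^ n) f).eval 0 / (n.factorial : ℂ)) • basic Q n := by
  induction d generalizing f with
  | zero =>
    rw [eq_C_of_natDegree_le_zero hf]
    simp [basic_zero, ← C_mul']
  | succ d ih =>
    have h1 := ih (Q.toLin f) ((Q.natDegree_toLin_le f).trans (by omega))
    -- A polynomial is determined by its image under $Q$ and its value at $0$, so it suffices that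
    -- both sides agree in these two respects.
    obtain ⟨q, -, hq⟩ := Q.existsUnique_preimage (Q.toLin f)
    have key : Q.toLin (∑ n ∈ Finset.range (d + 1 + 1),
        (((Q.toLin ^ n) f).eval 0 / (n.factorial : ℂ)) • basic Q n) = Q.toLin f := by
      conv_rhs => rw [h1]
      rw [map_sum, Finset.sum_range_succ']
      have h0 : Q.toLin (basic Q 0) = 0 := by rw [basic_zero, ← C_1, Q.map_const]
      rw [map_smul, h0, smul_zero, add_zero]
      refine Finset.sum_congr rfl fun n _ => ?_
      rw [map_smul, toLin_basic_succ, smul_smul, pow_succ, Module.End.mul_apply,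
        Nat.factorial_succ]
      congr 1
      have hn : ((n : ℂ) + 1) ≠ 0 := by exact_mod_cast n.succ_ne_zero
      push_cast
      field_simp
    have e1 := hq (f - C (f.eval 0)) ⟨by rw [map_sub, Q.map_const, sub_zero], by simp⟩
    have e2 := hq (∑ n ∈ Finset.range (d + 1 + 1),
        (((Q.toLin ^ n) f).eval 0 / (n.factorial : ℂ)) • basic Q n - C (f.eval 0))
        ⟨by rw [map_sub, Q.map_const, sub_zero, key], by
          rw [Finset.sum_range_succ']
          simp [eval_finsetSum, eval_basic_succ, basic_zero]⟩
    exact sub_left_inj.1 (e1.trans e2.symm)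

/-! ### Duality between polynomials and series in negative powers -/

/-- The pairing of `ℂ[x]` with `ℂ((u⁻¹))` in which `x^k` is dual to `(-1)^k u^{-1-k}`. -/
def dualPairing (g : LaurentSeries ℂ) : ℂ[X] →ₗ[ℂ] ℂ :=
  Polynomial.lsum fun k => ((-1) ^ k * g.coeff ((k : ℤ) + 1)) • LinearMap.id

theorem dualPairing_X_pow (g : LaurentSeries ℂ) (k : ℕ) :
    dualPairing g (X ^ k) = (-1) ^ k * g.coeff ((k : ℤ) + 1) := by
  rw [dualPairing, Polynomial.lsum_apply, ← monomial_one_right_eq_X_pow, sum_monomial_index]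
  · simp
  · simp

/-- The signs $(-1)^k$ in the pairing absorb the minus sign of integration by parts. -/
theorem dualPairing_xDeriv (g : LaurentSeries ℂ) (f : ℂ[X]) :
    dualPairing (xDeriv g) f = dualPairing g (derivative f) := by
  have : dualPairing (xDeriv g) = dualPairing g ∘ₗ derivative := by
    refine lhom_ext' fun k => LinearMap.ext_ring ?_
    simp only [LinearMap.comp_apply, monomial_one_right_eq_X_pow, derivative_X_pow,
      dualPairing_X_pow]
    rw [coeff_xDeriv, C_mul', map_smul]
    cases k with
    | zero => simp
    | succ k =>
      rw [Nat.add_sub_cancel, dualPairing_X_pow]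
      push_cast
      simp [pow_succ]
      ring
  rw [this, LinearMap.comp_apply]

theorem dualPairing_xDeriv_iterate (g : LaurentSeries ℂ) (n : ℕ) (f : ℂ[X]) :
    dualPairing (xDeriv^[n] g) f = dualPairing g (derivative^[n] f) := by
  induction n generalizing f with
  | zero => rfl
  | succ n ih => rw [Function.iterate_succ_apply', dualPairing_xDeriv, ih,
      Function.iterate_succ_apply]

theorem coeff_deltaSeries (Q : DeltaOperator) (g : LaurentSeries ℂ) (m : ℤ) :
    (deltaSeries Q g).coeff m = ∑ᶠ k, Q.symbolCoeff k * (xDeriv^[k] g).coeff m :=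
  HahnSeries.SummableFamily.coeff_hsum

/-- The action of `Q` on series is adjoint to its action on polynomials. -/
theorem dualPairing_deltaSeries (Q : DeltaOperator) (g : LaurentSeries ℂ) (f : ℂ[X]) :
    dualPairing (deltaSeries Q g) f = dualPairing g (Q.toLin f) := by
  have : dualPairing (deltaSeries Q g) = dualPairing g ∘ₗ Q.toLin := by
    refine lhom_ext' fun k => LinearMap.ext_ring ?_
    simp only [LinearMap.comp_apply, monomial_one_right_eq_X_pow]
    have hcoeff : ∀ j : ℕ, (xDeriv^[j] g).coeff ((k : ℤ) + 1) =
        (-1) ^ k * dualPairing g (derivative^[j] (X ^ k)) := fun j => by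
      rw [← dualPairing_xDeriv_iterate, dualPairing_X_pow, ← mul_assoc, ← mul_pow]
      simp
    rw [Q.toLin_eq_sum, map_sum, dualPairing_X_pow, coeff_deltaSeries,
      finsum_eq_sum_of_support_subset (s := Finset.range ((X ^ k : ℂ[X]).natDegree + 1)),
      Finset.mul_sum]
    · refine Finset.sum_congr rfl fun j _ => ?_
      rw [hcoeff, map_smul, smul_eq_mul, mul_left_comm ((-1 : ℂ) ^ k), ← mul_assoc ((-1 : ℂ) ^ k),
        ← mul_pow]
      simp
    · intro j hj
      by_contra hlt
      refine hj ?_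
      have hd : (X ^ k : ℂ[X]).natDegree < j := by simpa [-natDegree_X_pow] using hlt
      change Q.symbolCoeff j * _ = 0
      rw [hcoeff, iterate_derivative_eq_zero hd]
      simp
  rw [this, LinearMap.comp_apply]

/-- The functional of $u^{-1}$ is evaluation at $0$; each recursion step transfers one $Q$ to $f$ by
adjointness and divides by $-(n+1)$. -/
theorem dualPairing_basicStarNeg (Q : DeltaOperator) (n : ℕ) (f : ℂ[X]) :
    dualPairing (basicStarNeg Q n) f =
      (-1) ^ n * (((Q.toLin ^ n) f).eval 0 / (n.factorial : ℂ)) := by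
  induction n generalizing f with
  | zero =>
    have : dualPairing (basicStarNeg Q 0) = Polynomial.leval 0 := by
      refine lhom_ext' fun k => LinearMap.ext_ring ?_
      simp only [LinearMap.comp_apply, monomial_one_right_eq_X_pow, dualPairing_X_pow]
      cases k with
      | zero => simp [basicStarNeg, leval]
      | succ k =>
        rw [basicStarNeg, HahnSeries.coeff_single_of_ne (by push_cast; omega)]
        simp [leval]
    simp [this, leval]
  | succ n ih =>
    have hsmul : dualPairing (basicStarNeg Q (n + 1)) f =
        (-((n : ℂ) + 1))⁻¹ * dualPairing (deltaSeries Q (basicStarNeg Q n)) f := by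
      have : dualPairing (basicStarNeg Q (n + 1)) =
          (-((n : ℂ) + 1))⁻¹ • dualPairing (deltaSeries Q (basicStarNeg Q n)) := by
        refine lhom_ext' fun k => LinearMap.ext_ring ?_
        simp only [LinearMap.comp_apply, monomial_one_right_eq_X_pow, dualPairing_X_pow,
          LinearMap.smul_apply, basicStarNeg, HahnSeries.coeff_smul, smul_eq_mul]
        ring
      rw [this, LinearMap.smul_apply, smul_eq_mul]
    have hn : ((n : ℂ) + 1) ≠ 0 := by exact_mod_cast n.succ_ne_zero
    have hf : (n.factorial : ℂ) ≠ 0 := by exact_mod_cast n.factorial_ne_zero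
    rw [hsmul, dualPairing_deltaSeries, ih, pow_succ Q.toLin, Module.End.mul_apply,
      Nat.factorial_succ]
    push_cast
    field_simp
    ring

theorem coeff_basicStarNeg (Q : DeltaOperator) (n k : ℕ) :
    (basicStarNeg Q n).coeff ((k : ℤ) + 1) =
      (-1) ^ k * (-1) ^ n * (((Q.toLin ^ n) (X ^ k)).eval 0 / (n.factorial : ℂ)) := by
  rw [mul_assoc, ← dualPairing_basicStarNeg, dualPairing_X_pow, ← mul_assoc, ← mul_pow]
  simp

/-- Only powers `u^{-1-n}, u^{-2-n}, …` occur in `p*_{-1-n}(u)`. -/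
theorem coeff_basicStarNeg_of_le (Q : DeltaOperator) (n : ℕ) {m : ℤ} (hm : m ≤ n) :
    (basicStarNeg Q n).coeff m = 0 := by
  induction n generalizing m with
  | zero => exact HahnSeries.coeff_single_of_ne (by push_cast at hm; omega)
  | succ n ih =>
    -- Each $D$ raises the order in $u^{-1}$ by at least one; as $Q$ has no $D^0$ term, so does $Q$.
    have hD : ∀ (j : ℕ) (m : ℤ), m ≤ n + j → (xDeriv^[j] (basicStarNeg Q n)).coeff m = 0 := by
      intro j
      induction j with
      | zero => intro m hm; exact ih (by simpa using hm)
      | succ j hj =>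
        intro m hm
        obtain ⟨m, rfl⟩ : ∃ m', m = m' + 1 := ⟨m - 1, by ring⟩
        rw [Function.iterate_succ_apply', coeff_xDeriv, hj m (by push_cast at hm; omega)]
        simp
    rw [basicStarNeg, HahnSeries.coeff_smul, coeff_deltaSeries, finsum_eq_zero_of_forall_eq_zero,
      smul_zero]
    intro j
    cases j with
    | zero => rw [Q.symbolCoeff_zero, zero_mul]
    | succ j => rw [hD _ _ (by push_cast at hm ⊢; omega), mul_zero]

theorem basicStarZ_neg (Q : DeltaOperator) (n : ℕ) : basicStarZ Q (-1 - n) = basicStarNeg Q n := by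
  rw [show (-1 - n : ℤ) = Int.negSucc n by rw [Int.negSucc_eq]; ring]
  rfl

theorem basicZ_neg (Q : DeltaOperator) (n : ℕ) :
    basicZ Q (-1 - n) = invX ℂ * basicStarNeg Q (n + 1) := by
  rw [basicZ, ← basicStarZ_neg]
  congr 2
  push_cast
  ring

/-! ### Expansions of `(u + x)⁻¹` -/

theorem coeff_baseChange (N : ℕ) (f : LaurentSeries ℂ) (m : ℤ) :
    (baseChange N f).coeff m = algebraMap ℂ (RatField N) (f.coeff m) := rfl

theorem baseChange_invX_mul (N : ℕ) (f : LaurentSeries ℂ) :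
    baseChange N (invX ℂ * f) = invX (RatField N) * baseChange N f := by
  ext m
  obtain ⟨m, rfl⟩ : ∃ m', m = m' + -1 := ⟨m + 1, by ring⟩
  rw [coeff_baseChange, invX, invX, HahnSeries.coeff_single_mul_add,
    HahnSeries.coeff_single_mul_add, coeff_baseChange, one_mul, one_mul]

/-- `(u + x)⁻¹ = ∑_n (-1)^n p_n(x) p*_{-1-n}(u)`. -/
theorem hasFormalSum_basic (Q : DeltaOperator) (N : ℕ) (x : RatField N) :
    HasFormalSum (fun n : ℕ => HahnSeries.C ((-1) ^ n * aeval x (basic Q n)) *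
      baseChange N (basicStarZ Q (-1 - n))) (invX (RatField N) + HahnSeries.C x)⁻¹ := by
  have hcoeff : ∀ (n : ℕ) (m : ℤ), (HahnSeries.C ((-1) ^ n * aeval x (basic Q n)) *
      baseChange N (basicStarZ Q (-1 - n))).coeff m = (-1) ^ n * aeval x (basic Q n) *
        algebraMap ℂ (RatField N) ((basicStarNeg Q n).coeff m) := fun n m => by
    rw [HahnSeries.C_mul_eq_smul, HahnSeries.coeff_smul, coeff_baseChange, basicStarZ_neg,
      smul_eq_mul]
  refine HasFormalSum.of_coeff (fun n m hm => ?_) fun m => ?_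
  · rw [hcoeff, coeff_basicStarNeg_of_le Q n hm, map_zero, mul_zero]
  · by_cases hm : m ≤ 0
    · rw [coeff_inv_invX_add_C_of_nonpos x hm, Int.toNat_of_nonpos hm, Finset.sum_range_zero]
    · obtain ⟨k, rfl⟩ : ∃ k : ℕ, m = (k : ℤ) + 1 := ⟨(m - 1).toNat, by omega⟩
      have h := congrArg (aeval x) (eq_sum_basic Q k (X ^ k) (natDegree_X_pow k).le)
      rw [map_pow, aeval_X, map_sum] at h
      rw [coeff_inv_invX_add_C, neg_pow, h, Finset.mul_sum]
      refine Finset.sum_congr (congrArg _ (by omega)) fun n _ => ?_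
      rw [hcoeff, coeff_basicStarNeg, map_smul, Algebra.smul_def]
      simp only [map_mul, map_pow, map_neg, map_one]
      have h1 : ((-1 : RatField N) ^ n) * (-1) ^ n = 1 := by rw [← mul_pow]; simp
      linear_combination (aeval x (basic Q n) * (-1) ^ k * algebraMap ℂ (RatField N)
        (((Q.toLin ^ n) (X ^ k)).eval 0 / (n.factorial : ℂ))) * h1

theorem invX_add_C_ne_zero {K : Type*} [Field K] (x : K) : invX K + HahnSeries.C x ≠ 0 := by
  intro h
  have := congrArg (HahnSeries.coeff · (-1)) h
  simp [invX, HahnSeries.coeff_single_of_ne, HahnSeries.C_apply] at this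

/-- `(u + x)⁻¹ = ∑_n (-1)^n p*_n(x) p_{-1-n}(u)`. -/
theorem hasFormalSum_basicStar (Q : DeltaOperator) (N : ℕ) {x : RatField N} (hx : x ≠ 0) :
    HasFormalSum (fun n : ℕ => HahnSeries.C ((-1) ^ n * aeval x (basicStar Q n)) *
      baseChange N (basicZ Q (-1 - n))) (invX (RatField N) + HahnSeries.C x)⁻¹ := by
  set U := invX (RatField N) with hU
  have hC : (HahnSeries.C x : LaurentSeries (RatField N)) ≠ 0 := by
    simpa using hx
  have hUx : U + HahnSeries.C x ≠ 0 := invX_add_C_ne_zero x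
  have hU1 : U * HahnSeries.single 1 1 = 1 := by simp [hU, invX]
  have hS : baseChange N (basicStarZ Q (-1 - (0 : ℕ))) = HahnSeries.single 1 1 := by
    rw [basicStarZ_neg, basicStarNeg]
    ext m
    rw [coeff_baseChange, HahnSeries.coeff_single, HahnSeries.coeff_single]
    split_ifs <;> simp
  -- The term $n=0$ is $u^{-1}$, and $-\frac{u}{x}\bigl((u+x)^{-1}-u^{-1}\bigr)=(u+x)^{-1}$;
  -- termwise, $p_{n+1}(x)/x=p^*_n(x)$ and $u\,p^*_{-2-n}(u)=p_{-1-n}(u)$.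
  have h := (((hasFormalSum_basic Q N x).sub (HasFormalSum.single _)).drop 1
    (fun n hn => by
      obtain rfl : n = 0 := by omega
      rw [Pi.single_eq_same, sub_self])).mul_left (-(U * (HahnSeries.C x)⁻¹))
  convert h using 1
  · funext n
    rw [Pi.single_eq_of_ne (by omega), sub_zero, basicZ_neg, baseChange_invX_mul, basicStarZ_neg,
      add_comm 1 n, ← X_mul_basicStar, map_mul (aeval x), aeval_X, pow_succ, ← hU]
    simp only [map_mul, map_neg, map_one, map_pow]
    field_simp
  · rw [hS, basic_zero]
    simp only [pow_zero, map_one, mul_one, one_mul]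
    have h2 : (HahnSeries.single 1 1 : LaurentSeries (RatField N)) = U⁻¹ :=
      (inv_eq_of_mul_eq_one_right hU1).symm
    have hU0 : U ≠ 0 := left_ne_zero_of_mul_eq_one hU1
    rw [h2, ← hU]
    field_simp
    ring

/-! ### Determinants -/

/-- The passage from monomials to the $p_k$ is unitriangular, so only the order of the rows matters.
-/
theorem det_eval_perm {R : Type*} [CommRing R] {n : ℕ} (w : Fin n → R) (p : ℕ → R[X])
    (hdeg : ∀ k, (p k).natDegree = k) (hmonic : ∀ k, (p k).Monic) (σ : Equiv.Perm (Fin n)) :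
    (Matrix.of fun i j : Fin n => (p (σ i)).eval (w j)).det =
      (Equiv.Perm.sign σ : R) * (Matrix.vandermonde w).det := by
  rw [Matrix.det_eval_matrixOfPolynomials_eq_det_vandermonde w (fun i => p i)
    (fun i => hdeg i) (fun i => hmonic i), ← Matrix.det_transpose (Matrix.of _),
    ← Matrix.det_permute']
  rfl

/-- The two permutations list the row degrees as $M,\ldots,0$ and $0,M,\ldots,1$; they differ by a
cycle of length $M+1$. -/
theorem sign_revPerm_eq (M : ℕ) :
    Equiv.Perm.sign (Fin.revPerm : Equiv.Perm (Fin (M + 1))) =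
      (-1) ^ M * Equiv.Perm.sign (Equiv.neg (Fin (M + 1))) := by
  have : (Fin.revPerm : Equiv.Perm (Fin (M + 1))) = Equiv.neg (Fin (M + 1)) * finRotate (M + 1) := by
    ext i
    simp only [Equiv.Perm.mul_apply, finRotate_apply, Equiv.neg_apply, Fin.revPerm_apply]
    congr 1
    rw [neg_add_rev, ← Fin.last_sub]
    rw [eq_neg_of_add_eq_zero_left (Fin.last_add_one M), sub_eq_add_neg]
  rw [this, map_mul, sign_finRotate, mul_comm, Nat.add_sub_cancel]

/-- Replacing the polynomials `p_M` in the first row by `(u + x_j)⁻¹`. -/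
theorem prod_mul_det_updateRow_inv {L : Type*} [Field L] {M : ℕ} (u : L) (w : Fin (M + 1) → L)
    (hw : ∀ j, u + w j ≠ 0) (p : ℕ → L[X]) (hdeg : ∀ k, (p k).natDegree = k)
    (hmonic : ∀ k, (p k).Monic) :
    (∏ j, (u + w j)) * ((Matrix.of fun i j : Fin (M + 1) => (p (M - i)).eval (w j)).updateRow 0
      fun j => (u + w j)⁻¹).det =
      (-1) ^ M * (Matrix.of fun i j : Fin (M + 1) => (p (M - i)).eval (w j)).det := by
  -- These are the row polynomials once column $j$ is multiplied by $u+w_j$; again there is one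
  -- monic polynomial in each degree.
  let P : ℕ → L[X] := fun k => k.casesOn 1 fun k => (X + C u) * p k
  have hPm : ∀ k, (P k).Monic := by
    rintro (_ | k)
    · exact monic_one
    · exact (monic_X_add_C u).mul (hmonic k)
  have hPd : ∀ k, (P k).natDegree = k := by
    rintro (_ | k)
    · exact natDegree_one
    · change ((X + C u) * p k).natDegree = k + 1
      rw [(monic_X_add_C u).natDegree_mul (hmonic k), natDegree_X_add_C, hdeg, add_comm]
  have h1 := det_eval_perm w P hPd hPm (Equiv.neg (Fin (M + 1)))
  have h2 := det_eval_perm w p hdeg hmonic (Fin.revPerm (n := M + 1))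
  have h3 : (Matrix.of fun i j : Fin (M + 1) => (p (M - i)).eval (w j)) =
      Matrix.of fun i j : Fin (M + 1) => (p (Fin.revPerm i : Fin (M + 1))).eval (w j) := by
    ext i j
    simp [Fin.val_rev]
  rw [← Matrix.det_mul_row]
  have h4 : (Matrix.of fun i j => (u + w j) *
      ((Matrix.of fun i j : Fin (M + 1) => (p (M - i)).eval (w j)).updateRow 0
        fun j => (u + w j)⁻¹) i j) =
      Matrix.of fun i j : Fin (M + 1) => (P (Equiv.neg (Fin (M + 1)) i : Fin (M + 1))).eval (w j) := by
    ext i j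
    by_cases hi : i = 0
    · subst hi
      simp [P, mul_inv_cancel₀ (hw j)]
    -- Negation in `Fin (M + 1)` fixes $0$ and sends $i\ne0$ to $M+1-i$, which is the degree of the
    -- new row $i$.
    · have hv : ((-i : Fin (M + 1)) : ℕ) = (M - i) + 1 := by
        have h0 : (i : ℕ) ≠ 0 := fun h => hi (Fin.ext h)
        have := i.isLt
        rw [Fin.val_neg, if_neg hi]
        omega
      simp only [Matrix.of_apply, Equiv.neg_apply, hv, Matrix.updateRow_ne hi]
      simp [P, add_comm u]
  rw [h4, h1, h3, h2, sign_revPerm_eq, ← mul_assoc]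
  congr 1
  push_cast
  rw [← mul_assoc, ← mul_pow]
  simp

/-- The cofactors do not involve the new row, so the determinant can be taken term by term in a
formal sum. -/
theorem det_updateRow_eq_sum {R n : Type*} [CommRing R] [Fintype n] [DecidableEq n]
    (A : Matrix n n R) (i : n) (r : n → R) :
    (A.updateRow i r).det = ∑ j, A.adjugate j i * r j := by
  rw [← Matrix.cramer_transpose_apply, Matrix.cramer_eq_adjugate_mulVec, ← Matrix.adjugate_transpose]
  rfl

/-! ### One-row Schur type functions. -/

theorem schurNum_oneRow {M : ℕ} (q : ℕ → ℂ[X]) (l : ℕ) :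
    schurNum q (oneRow (M + 1) l) =
      ((Matrix.of fun i j : Fin (M + 1) => aeval (var (M + 1) j) (q (M - i))).updateRow 0
        fun j => aeval (var (M + 1) j) (q (M + l))).det := by
  rw [schurNum]
  congr 1
  ext i j
  by_cases hi : i = 0
  · subst hi
    simp [oneRow, add_comm]
  · simp [oneRow, hi]

theorem var_injective (N : ℕ) : Function.Injective (var N) :=
  (IsFractionRing.injective (MvPolynomial (Fin N) ℂ) (RatField N)).comp
    (MvPolynomial.X_injective)

theorem var_ne_zero (N : ℕ) (j : Fin N) : var N j ≠ 0 := by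
  rw [var, Ne, map_eq_zero_iff _ (IsFractionRing.injective (MvPolynomial (Fin N) ℂ) (RatField N))]
  exact MvPolynomial.X_ne_zero j

/-- Up to sign this is the Vandermonde determinant of distinct variables. -/
theorem schurNum_zero_ne_zero {M : ℕ} (q : ℕ → ℂ[X]) (hdeg : ∀ k, (q k).natDegree = k)
    (hmonic : ∀ k, (q k).Monic) : (schurNum q 0 : RatField (M + 1)) ≠ 0 := by
  have h := det_eval_perm (var (M + 1)) (fun k => (q k).map (algebraMap ℂ (RatField (M + 1))))
    (fun k => by rw [(hmonic k).natDegree_map, hdeg]) (fun k => (hmonic k).map _)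
    (Fin.revPerm (n := M + 1))
  have h1 : (schurNum q 0 : RatField (M + 1)) =
      (Matrix.of fun i j : Fin (M + 1) => ((q (Fin.revPerm i : Fin (M + 1))).map
        (algebraMap ℂ (RatField (M + 1)))).eval (var (M + 1) j)).det := by
    rw [schurNum]
    congr 1
    ext i j
    simp [Fin.val_rev, eval_map_algebraMap]
  rw [h1, h]
  refine mul_ne_zero ?_ (Matrix.det_vandermonde_ne_zero_iff.2 (var_injective _))
  rcases Int.units_eq_one_or (Equiv.Perm.sign (Fin.revPerm : Equiv.Perm (Fin (M + 1)))) with h | h <;>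
    simp [h]

/-- An expansion of `(u + x)⁻¹` in monic polynomials in `x` yields an expansion of
`∏ (u + x_j)⁻¹` in the corresponding one-row Schur type functions. -/
theorem hasFormalSum_prod_inv {M : ℕ} (q : ℕ → ℂ[X]) (hdeg : ∀ k, (q k).natDegree = k)
    (hmonic : ∀ k, (q k).Monic) (φ : ℕ → LaurentSeries (RatField (M + 1)))
    (h : ∀ j, HasFormalSum
      (fun n : ℕ => HahnSeries.C ((-1) ^ n * aeval (var (M + 1) j) (q n)) * φ n)
      (invX (RatField (M + 1)) + HahnSeries.C (var (M + 1) j))⁻¹) :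
    HasFormalSum (fun l : ℕ =>
        HahnSeries.C ((-1) ^ l * schur q (oneRow (M + 1) l)) * φ (M + l))
      (∏ j, (invX (RatField (M + 1)) + HahnSeries.C (var (M + 1) j)))⁻¹ := by
  set K := RatField (M + 1)
  set y := var (M + 1)
  let A : Matrix (Fin (M + 1)) (Fin (M + 1)) K := Matrix.of fun i j => aeval (y j) (q (M - i))
  have hA : A.det = schurNum q 0 := by
    rw [schurNum]
    congr 1
    ext i j
    simp [A, y]
  have hA0 : A.det ≠ 0 := hA ▸ schurNum_zero_ne_zero q hdeg hmonic
  have h1 := HasFormalSum.sum Finset.univ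
    fun j => (h j).mul_left (HahnSeries.C (A.adjugate j 0))
  have hterm : ∀ n, ∑ j, HahnSeries.C (A.adjugate j 0) *
      (HahnSeries.C ((-1) ^ n * aeval (y j) (q n)) * φ n) =
      HahnSeries.C ((-1) ^ n * (A.updateRow 0 fun j => aeval (y j) (q n)).det) * φ n := fun n => by
    rw [det_updateRow_eq_sum, Finset.mul_sum, map_sum, Finset.sum_mul]
    refine Finset.sum_congr rfl fun j _ => ?_
    rw [← mul_assoc, ← map_mul]
    congr 2
    ring
  simp only [hterm] at h1
  have h2 := (h1.drop M fun n hn => by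
    have : (A.updateRow 0 fun j => aeval (y j) (q n)).det = 0 := by
      -- Row $M-n$ of `A` already consists of the $q_n(x_j)$.
      have hne : (0 : Fin (M + 1)) ≠ ⟨M - n, by omega⟩ := fun h => by
        have := congrArg Fin.val h
        change 0 = M - n at this
        omega
      refine Matrix.det_zero_of_row_eq hne ?_
      rw [Matrix.updateRow_self, Matrix.updateRow_ne hne.symm]
      ext j
      simp [A, Nat.sub_sub_self hn.le]
    rw [this, mul_zero, map_zero, zero_mul]).mul_left (HahnSeries.C ((-1) ^ M * A.det⁻¹))
  convert h2 using 1
  · funext l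
    rw [← mul_assoc, ← map_mul, schur, schurNum_oneRow, ← hA]
    congr 2
    rw [pow_add]
    have h3 : ((-1 : K) ^ M) * (-1) ^ M = 1 := by
      rw [← mul_pow, neg_mul_neg, one_mul, one_pow]
    field_simp
    linear_combination (-(A.updateRow 0 fun j => aeval (y j) (q (M + l))).det) * h3
  · have hw := fun j => invX_add_C_ne_zero (y j)
    -- The determinant identity is applied over the field $K((u^{-1}))$, with the $x_j$ and the
    -- coefficients of the $q_k$ as constants.
    have h4 := prod_mul_det_updateRow_inv (invX K) (fun j => HahnSeries.C (y j)) hw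
      (fun k => ((q k).map (algebraMap ℂ K)).map HahnSeries.C)
      (fun k => by rw [((hmonic k).map _).natDegree_map, (hmonic k).natDegree_map, hdeg])
      (fun k => ((hmonic k).map _).map _)
    have h5 : (Matrix.of fun i j : Fin (M + 1) => (((q (M - i)).map (algebraMap ℂ K)).map
        HahnSeries.C).eval (HahnSeries.C (y j) : LaurentSeries K)) =
        (HahnSeries.C : K →+* LaurentSeries K).mapMatrix A := by
      ext i j : 2
      simp only [A, Matrix.of_apply, RingHom.mapMatrix_apply, Matrix.map_apply, eval_map_apply,
        eval_map_algebraMap]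
    rw [h5, det_updateRow_eq_sum, ← RingHom.map_adjugate, ← RingHom.map_det] at h4
    have h6 : (HahnSeries.C A.det : LaurentSeries K) ≠ 0 := by simpa using hA0
    have h7 : ((-1 : LaurentSeries K) ^ M) * (-1) ^ M = 1 := by rw [← mul_pow]; simp
    refine inv_eq_of_mul_eq_one_right ?_
    rw [mul_left_comm]
    refine (congrArg _ h4).trans ?_
    simp only [map_mul, map_pow, map_neg, map_one, map_inv₀]
    field_simp
    linear_combination h7

end BinomialSchur

end

theorem theorem5p2 (Q : BinomialSchur.DeltaOperator) (hQ : Q.IsNormalized) (N : ℕ) (hN : 1 ≤ N) :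
    BinomialSchur.HasFormalSum
      (fun l : ℕ => HahnSeries.C ((-1) ^ l * BinomialSchur.hSchur Q N l) *
        BinomialSchur.baseChange N (BinomialSchur.basicStarZ Q (-(N : ℤ) - (l : ℤ))))
      (∏ j : Fin N, (BinomialSchur.invX (BinomialSchur.RatField N) +
        HahnSeries.C (BinomialSchur.var N j)))⁻¹ ∧
    BinomialSchur.HasFormalSum
      (fun l : ℕ => HahnSeries.C ((-1) ^ l * BinomialSchur.hStarSchur Q N l) *
        BinomialSchur.baseChange N (BinomialSchur.basicZ Q (-(N : ℤ) - (l : ℤ))))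
      (∏ j : Fin N, (BinomialSchur.invX (BinomialSchur.RatField N) +
        HahnSeries.C (BinomialSchur.var N j)))⁻¹ := by
  obtain ⟨M, rfl⟩ := Nat.exists_eq_add_of_le' hN
  -- With $N=M+1$, the index $-N-l$ is that of the kernel term $n=M+l$.
  have hidx : ∀ l : ℕ, (-((M + 1 : ℕ) : ℤ) - l) = -1 - ((M + l : ℕ) : ℤ) := fun l => by
    push_cast
    ring
  simp only [hidx, BinomialSchur.hSchur, BinomialSchur.hStarSchur]
  exact ⟨BinomialSchur.hasFormalSum_prod_inv (BinomialSchur.basic Q)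
      (BinomialSchur.natDegree_basic Q) (BinomialSchur.monic_basic Q hQ)
      (fun n => BinomialSchur.baseChange (M + 1) (BinomialSchur.basicStarZ Q (-1 - n)))
      fun j => BinomialSchur.hasFormalSum_basic Q (M + 1) (BinomialSchur.var (M + 1) j),
    BinomialSchur.hasFormalSum_prod_inv (BinomialSchur.basicStar Q)
      (BinomialSchur.natDegree_basicStar Q) (BinomialSchur.monic_basicStar Q hQ)
      (fun n => BinomialSchur.baseChange (M + 1) (BinomialSchur.basicZ Q (-1 - n)))
      fun j => BinomialSchur.hasFormalSum_basicStar Q (M + 1) (BinomialSchur.var_ne_zero (M + 1) j)⟩
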